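/- Call a compact set $F\subset\mathbb{C}$ with at least two points uniformly perfect if there is a constant $C$ such that $\log(R/r)\le C$ for every annulus $A=\{z: r<|z-w|<R\}$ ($w\in\mathbb{C}$, $0<r<R$) separating $F$, i.e. such that $F\cap A=\emptyset$ and $F$ meets both components of $\mathbb{C}\setminus A$. Call a compact set $E\subset\mathbb{C}$ hereditarily non uniformly perfect (HNUP) if no subset of $E$ is uniformly perfect. For compact nonempty $E\subset\mathbb{C}$ let $\operatorname{Cap}E=\lim_{n\to\infty}P_n^{2/(n(n-1))}$, where $P_n=\max\prod_{j<k}|z_j-z_k|$ over $z_1,\dots,z_n\in E$, denote its logarithmic capacity. Let $H^s$ and $\dim_H$ denote $s$-dimensional Hausdorff measure (the limit as $\epsilon\to0^+$ of the infima of $\sum_k \operatorname{diam}(B_k)^s$ over countable covers by sets of diameter less than $\epsilon$) and Hausdorff dimension, and regard $\mathbb{R}\subset\mathbb{C}$. Theorem. There exists a compact HNUP set $W\subset\mathbb{R}$ such that $\dim_H W=1$, $H^1(W)=0$ and $\operatorname{Cap}W>0$. Hence, for any $0<s<1$ and any $0<c<\infty$, there exists a compact HNUP subset $K$ of $W$ such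 that $\dim_H K=s$ and $H^s(K)=c$. Moreover, $W$ can be arranged to satisfy in addition: for each $x\in W$ and each $M>1$ there exist positive numbers $r,R$ with $R/r\ge M$ such that $\{y\in\mathbb{R}: r<|y-x|<R\}\subset\mathbb{R}\setminus W$ and $\{y\in\mathbb{R}: |y-x|\ge R\}\cap W\ne\emptyset$. -/

import Mathlib

open Filter Topology MeasureTheory

/-- The open round annulus `{z : r < |z - w| < R}` in the complex plane. -/
def Ann (w : ℂ) (r R : ℝ) : Set ℂ := {z | r < ‖z - w‖ ∧ ‖z - w‖ < R}

/-- For `0 < r < R`, the annulus `Ann w r R` separates `F`: it is disjoint from `F`, and `F` meets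
both components of its complement, namely the closed disc `|z - w| ≤ r` and the closed exterior
`|z - w| ≥ R`. -/
def AnnSeparates (w : ℂ) (r R : ℝ) (F : Set ℂ) : Prop :=
  (F ∩ {z | ‖z - w‖ ≤ r}).Nonempty ∧ (F ∩ {z | R ≤ ‖z - w‖}).Nonempty ∧ F ∩ Ann w r R = ∅

/-- A compact set with at least two points is uniformly perfect if the moduli `log (R / r)` of the
annuli separating it are bounded above. -/
def UniformlyPerfect (F : Set ℂ) : Prop :=
  IsCompact F ∧ F.Nontrivial ∧
    ∃ C : ℝ, ∀ (w : ℂ) (r R : ℝ), 0 < r → r < R → AnnSeparates w r R F → Real.log (R / r) ≤ C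

/-- Hereditarily non uniformly perfect: compact, with no uniformly perfect subset. -/
def HNUP (E : Set ℂ) : Prop :=
  IsCompact E ∧ ∀ F : Set ℂ, F ⊆ E → ¬ UniformlyPerfect F

/-- `P_n`: the largest product of the mutual distances of `n` points of `E`. The supremum is a
maximum when `E` is compact and nonempty. -/
noncomputable def maxDistProd (E : Set ℂ) (n : ℕ) : ℝ :=
  ⨆ z : Fin n → E, ∏ j : Fin n, ∏ k ∈ Finset.Ioi j, ‖(z j : ℂ) - (z k : ℂ)‖

/-- `D_n = P_n ^ (2 / (n (n - 1)))`, the `n`-th diameter of `E`. -/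
noncomputable def nthDiameter (E : Set ℂ) (n : ℕ) : ℝ :=
  maxDistProd E n ^ (2 / ((n : ℝ) * ((n : ℝ) - 1)))

/-- `κ` is the logarithmic capacity (transfinite diameter) of the compact set `E`: the limit of
the `n`-th diameters. -/
def IsLogCapacity (E : Set ℂ) (κ : ℝ) : Prop :=
  Tendsto (nthDiameter E) atTop (𝓝 κ)

/-! W is the set of subsums of `∑ c i`, where `c i = 2 ^ (-(i + ⌊log₂ i⌋ ^ 2))`. Because `2 * c (i +
1) ≤ c i`, digits from place `p` on contribute at most `2 * c p`, and distinct prefixes of length `p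
+ 1` have sums at least `c p` apart. The size of W is thus governed by `2 ^ p * c p ^ s`. If this is
bounded below, sending a subsum to the number with the same binary digits is an `s`-Hölder map onto
`[0, 1]` (`ofDigits_holder`), so `H^s` is positive. Covering by `2 ^ p` intervals of length `2 * c
p` gives the upper bound.

The exponent `⌊log₂ i⌋ ^ 2` is `o(i)`, so `2 ^ i * c i ^ s → ∞` for `s < 1`; yet it is unbounded, so
`2 ^ i * c i` is arbitrarily small and `H^1(W) = 0`. It jumps at powers of 2 by unbounded amounts,
so the ratios `c i / c (i + 1)` are unbounded. Distances in W avoid `(2 c (i + 1), c i - 2 c (i +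
1))` (`gap`), which puts wide empty annuli around every point and excludes uniformly perfect
subsets.

For measure `c` in dimension `s < 1`, a subsequence of a tail is chosen so that `2 ^ p * c (σ p) ^
s` stays above `t` and is infinitely often at most `2 t`: its subsums have finite positive measure.
Restoring the omitted initial digits doubles this measure until it reaches `c`, and cutting by a
half-line makes it equal to `c`. Letting `s → 1` gives dimension 1.

Capacity is positive because the `1/2`-Hölder map lets preimages of `j / n` serve as well separated
points. -/

/-! ### Sets of subsums of rapidly decreasing series -/

/-- A positive sequence each of whose terms is at least twice the next one. -/
structure Halving (c : ℕ → ℝ) : Prop where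
  pos : ∀ i, 0 < c i
  half : ∀ i, 2 * c (i + 1) ≤ c i

/-- The subsum of `∑ c i` selected by the binary digits `d`. -/
noncomputable def subsum (c : ℕ → ℝ) (d : ℕ → Fin 2) : ℝ := ∑' i, ((d i : ℕ) : ℝ) * c i

/-- The set of all subsums of `∑ c i`. -/
noncomputable def subsumSet (c : ℕ → ℝ) : Set ℝ := Set.range (subsum c)

/-- The integer with binary expansion `d 0, …, d (p - 1)`. -/
def prefixInt (d : ℕ → Fin 2) : ℕ → ℤ
  | 0 => 0
  | p + 1 => 2 * prefixInt d p + (d p : ℕ)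

lemma fin_two_cast_le_one (a : Fin 2) : ((a : ℕ) : ℝ) ≤ 1 := by
  have : (a : ℕ) ≤ 1 := by omega
  exact_mod_cast this

namespace Halving

variable {c : ℕ → ℝ}

lemma shift (hc : Halving c) (n : ℕ) : Halving (fun i => c (i + n)) :=
  ⟨fun i => hc.pos _, fun i => by
    have := hc.half (i + n)
    rwa [show i + n + 1 = i + 1 + n by omega] at this⟩

lemma pow_mul_le (hc : Halving c) (n q : ℕ) : 2 ^ q * c (n + q) ≤ c n := by
  induction q with
  | zero => simp
  | succ q ih =>
    have := hc.half (n + q)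
    calc (2 : ℝ) ^ (q + 1) * c (n + (q + 1)) = 2 ^ q * (2 * c (n + q + 1)) := by
          rw [pow_succ, add_assoc]; ring
      _ ≤ 2 ^ q * c (n + q) := by gcongr
      _ ≤ c n := ih

lemma antitone (hc : Halving c) : Antitone c :=
  antitone_nat_of_succ_le fun n => by linarith [hc.half n, hc.pos (n + 1)]

lemma comp (hc : Halving c) {σ : ℕ → ℕ} (hσ : StrictMono σ) : Halving (fun i => c (σ i)) :=
  ⟨fun i => hc.pos _, fun i => by
    have h1 := hc.half (σ i)
    have h2 := hc.antitone (Nat.succ_le_of_lt (hσ (Nat.lt_succ_self i)))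
    simp only [Nat.succ_eq_add_one] at h2
    linarith⟩

lemma le_geometric (hc : Halving c) (n : ℕ) : c n ≤ c 0 * (1 / 2) ^ n := by
  have := hc.pow_mul_le 0 n
  rw [zero_add] at this
  rw [one_div, inv_pow, ← div_eq_mul_inv, le_div_iff₀ (by positivity)]
  linarith

lemma tendsto_zero (hc : Halving c) : Tendsto c atTop (𝓝 0) := by
  refine squeeze_zero (fun n => (hc.pos n).le) hc.le_geometric ?_
  simpa using (tendsto_pow_atTop_nhds_zero_of_lt_one (r := (1 / 2 : ℝ)) (by norm_num)
    (by norm_num)).const_mul (c 0)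

lemma term_nonneg (hc : Halving c) (d : ℕ → Fin 2) (i : ℕ) : 0 ≤ ((d i : ℕ) : ℝ) * c i :=
  mul_nonneg (Nat.cast_nonneg _) (hc.pos i).le

lemma term_le (hc : Halving c) (d : ℕ → Fin 2) (i : ℕ) :
    ((d i : ℕ) : ℝ) * c i ≤ c 0 * (1 / 2) ^ i :=
  (mul_le_of_le_one_left (hc.pos i).le (fin_two_cast_le_one _)).trans (hc.le_geometric i)

lemma summable (hc : Halving c) (d : ℕ → Fin 2) : Summable fun i => ((d i : ℕ) : ℝ) * c i :=
  Summable.of_nonneg_of_le (hc.term_nonneg d) (hc.term_le d) (summable_geometric_two.mul_left _)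

lemma subsum_nonneg (hc : Halving c) (d : ℕ → Fin 2) : 0 ≤ subsum c d :=
  tsum_nonneg (hc.term_nonneg d)

lemma subsum_le (hc : Halving c) (d : ℕ → Fin 2) : subsum c d ≤ 2 * c 0 := by
  calc subsum c d ≤ ∑' i : ℕ, c 0 * (1 / 2) ^ i :=
        (hc.summable d).tsum_mono (summable_geometric_two.mul_left _) (hc.term_le d)
    _ = 2 * c 0 := by rw [tsum_mul_left, tsum_geometric_two, mul_comm]

lemma subsum_split (hc : Halving c) (d : ℕ → Fin 2) (p : ℕ) :
    subsum c d = ∑ i ∈ Finset.range p, ((d i : ℕ) : ℝ) * c i +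
      subsum (fun i => c (i + p)) (fun i => d (i + p)) :=
  ((hc.summable d).sum_add_tsum_nat_add p).symm

lemma isCompact_subsumSet (hc : Halving c) : IsCompact (subsumSet c) := by
  refine isCompact_range (continuous_tsum (fun i => ?_)
    (summable_geometric_two.mul_left (c 0)) (fun i d => ?_))
  · exact ((continuous_of_discreteTopology (f := fun a : Fin 2 => ((a : ℕ) : ℝ))).comp
      (continuous_apply i)).mul continuous_const
  · rw [Real.norm_of_nonneg (hc.term_nonneg d i)]
    exact hc.term_le d i

lemma zero_mem (c : ℕ → ℝ) : (0 : ℝ) ∈ subsumSet c := ⟨fun _ => 0, by simp [subsum]⟩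

lemma apply_zero_mem (c : ℕ → ℝ) : c 0 ∈ subsumSet c := by
  refine ⟨fun i => if i = 0 then 1 else 0, ?_⟩
  rw [subsum, tsum_eq_single 0]
  · simp
  · intro i hi; simp [hi]

/-- Prefix sums are separated at least as much as the integers coding the prefixes. -/
lemma prefix_separation (hc : Halving c) (d e : ℕ → Fin 2) (p : ℕ)
    (h : prefixInt e (p + 1) ≤ prefixInt d (p + 1)) :
    ((prefixInt d (p + 1) - prefixInt e (p + 1) : ℤ) : ℝ) * c p ≤
      ∑ i ∈ Finset.range (p + 1), ((d i : ℕ) : ℝ) * c i -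
        ∑ i ∈ Finset.range (p + 1), ((e i : ℕ) : ℝ) * c i := by
  induction p generalizing d e with
  | zero => simp [prefixInt, sub_mul]
  | succ p ih =>
    rw [Finset.sum_range_succ _ (p + 1), Finset.sum_range_succ _ (p + 1)]
    have hd : prefixInt d (p + 1 + 1) = 2 * prefixInt d (p + 1) + (d (p + 1) : ℕ) := rfl
    have he : prefixInt e (p + 1 + 1) = 2 * prefixInt e (p + 1) + (e (p + 1) : ℕ) := rfl
    rw [hd, he] at h ⊢
    -- The last digits differ by at most 1, so the order of the longer codes forces that of the
    -- shorter ones. The sign is needed to multiply `2 * c (p + 1) ≤ c p` by the difference.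
    have hle : prefixInt e (p + 1) ≤ prefixInt d (p + 1) := by omega
    have h1 := ih d e hle
    have h2 := hc.half p
    have h3 : (0 : ℝ) ≤ ((prefixInt d (p + 1) - prefixInt e (p + 1) : ℤ) : ℝ) := by
      exact_mod_cast sub_nonneg.2 hle
    push_cast at h1 h3 ⊢
    nlinarith

lemma prefix_separation_abs (hc : Halving c) (d e : ℕ → Fin 2) (p : ℕ) :
    |((prefixInt d (p + 1) - prefixInt e (p + 1) : ℤ) : ℝ)| * c p ≤
      |∑ i ∈ Finset.range (p + 1), ((d i : ℕ) : ℝ) * c i -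
        ∑ i ∈ Finset.range (p + 1), ((e i : ℕ) : ℝ) * c i| := by
  rcases le_total (prefixInt e (p + 1)) (prefixInt d (p + 1)) with h | h
  · rw [abs_of_nonneg (by exact_mod_cast sub_nonneg.2 h)]
    exact (hc.prefix_separation d e p h).trans (le_abs_self _)
  · rw [← neg_sub, Int.cast_neg, abs_neg, abs_of_nonneg (by exact_mod_cast sub_nonneg.2 h),
      abs_sub_comm]
    exact (hc.prefix_separation e d p h).trans (le_abs_self _)

lemma prefix_eq_of_prefixInt_eq (hc : Halving c) (d e : ℕ → Fin 2) (p : ℕ)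
    (h : prefixInt d (p + 1) = prefixInt e (p + 1)) :
    ∑ i ∈ Finset.range (p + 1), ((d i : ℕ) : ℝ) * c i =
      ∑ i ∈ Finset.range (p + 1), ((e i : ℕ) : ℝ) * c i := by
  have h1 := hc.prefix_separation d e p h.ge
  have h2 := hc.prefix_separation e d p h.le
  simp only [h, sub_self, Int.cast_zero, zero_mul] at h1 h2
  linarith

lemma abs_sub_prefix_le (hc : Halving c) (d e : ℕ → Fin 2) (p : ℕ) :
    |(subsum c d - subsum c e) - (∑ i ∈ Finset.range (p + 1), ((d i : ℕ) : ℝ) * c i -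
        ∑ i ∈ Finset.range (p + 1), ((e i : ℕ) : ℝ) * c i)| ≤ 2 * c (p + 1) := by
  rw [hc.subsum_split d (p + 1), hc.subsum_split e (p + 1)]
  have h1 := (hc.shift (p + 1)).subsum_nonneg (fun i => d (i + (p + 1)))
  have h2 := (hc.shift (p + 1)).subsum_nonneg (fun i => e (i + (p + 1)))
  have h3 := (hc.shift (p + 1)).subsum_le (fun i => d (i + (p + 1)))
  have h4 := (hc.shift (p + 1)).subsum_le (fun i => e (i + (p + 1)))
  simp only [zero_add] at h3 h4
  rw [abs_le]
  constructor <;> linarith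

/-- Distances between subsums avoid the interval `(2 c (i + 1), c i - 2 c (i + 1))`. -/
lemma gap (hc : Halving c) {x y : ℝ} (hx : x ∈ subsumSet c) (hy : y ∈ subsumSet c) (i : ℕ) :
    |y - x| ≤ 2 * c (i + 1) ∨ c i - 2 * c (i + 1) ≤ |y - x| := by
  obtain ⟨e, rfl⟩ := hx
  obtain ⟨d, rfl⟩ := hy
  have h1 := hc.abs_sub_prefix_le d e i
  by_cases h : prefixInt d (i + 1) = prefixInt e (i + 1)
  · left
    rw [hc.prefix_eq_of_prefixInt_eq d e i h, sub_self, sub_zero] at h1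
    exact h1
  · right
    have h2 := hc.prefix_separation_abs d e i
    have h3 : (1 : ℝ) ≤ |((prefixInt d (i + 1) - prefixInt e (i + 1) : ℤ) : ℝ)| := by
      exact_mod_cast Int.one_le_abs (sub_ne_zero.2 h)
    have h4 := mul_le_mul_of_nonneg_right h3 (hc.pos i).le
    have h5 := abs_sub_abs_le_abs_sub
      (∑ i ∈ Finset.range (i + 1), ((d i : ℕ) : ℝ) * c i -
        ∑ i ∈ Finset.range (i + 1), ((e i : ℕ) : ℝ) * c i) (subsum c d - subsum c e)
    rw [abs_sub_comm _ (subsum c d - subsum c e)] at h5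
    linarith

lemma ofDigits_eq (d : ℕ → Fin 2) (p : ℕ) :
    Real.ofDigits d = ((2 : ℝ) ^ p)⁻¹ * (prefixInt d p + Real.ofDigits (fun i => d (i + p))) := by
  have h : ∀ p, ∑ i ∈ Finset.range p, Real.ofDigitsTerm d i = ((2 : ℝ) ^ p)⁻¹ * prefixInt d p := by
    intro p
    induction p with
    | zero => simp [prefixInt]
    | succ p ih =>
      rw [Finset.sum_range_succ, ih, Real.ofDigitsTerm, prefixInt]
      push_cast
      field_simp
      ring
  rw [Real.ofDigits_eq_sum_add_ofDigits d p, h, mul_add]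
  norm_num

lemma ofDigits_sub_le (hc : Halving c) (d e : ℕ → Fin 2) (p : ℕ) :
    |Real.ofDigits d - Real.ofDigits e| ≤
      ((2 : ℝ) ^ (p + 1))⁻¹ * (|subsum c d - subsum c e| / c p + 2) := by
  have hp := hc.pos p
  have h0 := Real.ofDigits_nonneg (fun i => d (i + (p + 1)))
  have h1 := Real.ofDigits_nonneg (fun i => e (i + (p + 1)))
  have h2 := Real.ofDigits_le_one (fun i => d (i + (p + 1)))
  have h3 := Real.ofDigits_le_one (fun i => e (i + (p + 1)))
  rw [ofDigits_eq d (p + 1), ofDigits_eq e (p + 1), ← mul_sub, abs_mul,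
    abs_of_pos (by positivity : (0 : ℝ) < ((2 : ℝ) ^ (p + 1))⁻¹)]
  gcongr
  have h4 : |((prefixInt d (p + 1) - prefixInt e (p + 1) : ℤ) : ℝ)| ≤
      |subsum c d - subsum c e| / c p + 1 := by
    have h5 := hc.prefix_separation_abs d e p
    have h6 := hc.abs_sub_prefix_le d e p
    have h7 := abs_sub_abs_le_abs_sub
      (∑ i ∈ Finset.range (p + 1), ((d i : ℕ) : ℝ) * c i -
        ∑ i ∈ Finset.range (p + 1), ((e i : ℕ) : ℝ) * c i) (subsum c d - subsum c e)
    rw [abs_sub_comm _ (subsum c d - subsum c e)] at h7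
    have h8 := hc.half p
    rw [div_add_one hp.ne', le_div_iff₀ hp]
    linarith
  push_cast at h4
  rw [abs_le] at h4 ⊢
  constructor <;> linarith

/-- The map from subsums to binary expansions is Hölder when `2 ^ p * c p ^ s` is bounded below. -/
lemma ofDigits_holder (hc : Halving c) {s t : ℝ} (hs : 0 < s) (ht : 0 < t)
    (h : ∀ p : ℕ, t ≤ 2 ^ p * c p ^ s) (d e : ℕ → Fin 2) :
    |Real.ofDigits d - Real.ofDigits e| ≤ 3 / t * |subsum c d - subsum c e| ^ s := by
  set a := |subsum c d - subsum c e| with ha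
  rcases (abs_nonneg (subsum c d - subsum c e)).eq_or_lt with h0 | h0
  · rw [← ha] at h0
    rw [← h0, Real.zero_rpow hs.ne', mul_zero]
    have hlim : Tendsto (fun p : ℕ => ((2 : ℝ) ^ (p + 1))⁻¹ * 2) atTop (𝓝 0) := by
      have h1 : Tendsto (fun p : ℕ => (1 / 2 : ℝ) ^ p) atTop (𝓝 0) :=
        tendsto_pow_atTop_nhds_zero_of_lt_one (by norm_num) (by norm_num)
      refine h1.congr fun p => ?_
      rw [one_div, inv_pow, pow_succ]
      field_simp
    refine ge_of_tendsto' hlim fun p => ?_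
    have := hc.ofDigits_sub_le d e p
    rwa [← ha, ← h0, zero_div, zero_add] at this
  -- Take the first `p` with `c p ≤ a`. Then `2 ^ (-p) ≤ a ^ s / t`, while `a < c (p - 1)` bounds
  -- the difference of binary values by `3 * 2 ^ (-p)`.
  · have hex : ∃ p, c p ≤ a :=
      ((hc.tendsto_zero.eventually (eventually_lt_nhds h0)).exists).imp fun _ h => h.le
    classical
    obtain ⟨hp, hmin⟩ : c (Nat.find hex) ≤ a ∧ ∀ m < Nat.find hex, ¬ c m ≤ a :=
      ⟨Nat.find_spec hex, fun m => Nat.find_min hex⟩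
    generalize Nat.find hex = p at hp hmin
    have key : ((2 : ℝ) ^ p)⁻¹ ≤ 1 / t * a ^ s := by
      have h1 : c p ^ s ≤ a ^ s := Real.rpow_le_rpow (hc.pos p).le hp hs.le
      have h2 := h p
      rw [inv_le_iff_one_le_mul₀ (by positivity)]
      rw [one_div, inv_mul_eq_div, div_mul_eq_mul_div, one_le_div ht]
      nlinarith [pow_pos (two_pos : (0 : ℝ) < 2) p]
    have h3 : |Real.ofDigits d - Real.ofDigits e| ≤ 3 * ((2 : ℝ) ^ p)⁻¹ := by
      rcases p with _ | q
      · have h4 := Real.ofDigits_nonneg d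
        have h5 := Real.ofDigits_nonneg e
        have h6 := Real.ofDigits_le_one d
        have h7 := Real.ofDigits_le_one e
        rw [abs_le]
        constructor <;> norm_num <;> linarith
      · have h4 := hc.ofDigits_sub_le d e q
        have h5 : a / c q ≤ 1 :=
          (div_le_one (hc.pos q)).2 (not_le.1 (hmin q (Nat.lt_succ_self q))).le
        rw [mul_comm]
        refine h4.trans ?_
        gcongr
        linarith
    calc _ ≤ 3 * ((2 : ℝ) ^ p)⁻¹ := h3
      _ ≤ 3 * (1 / t * a ^ s) := by gcongr
      _ = 3 / t * a ^ s := by ring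

lemma exists_holder_surjOn (hc : Halving c) {s t : ℝ} (hs : 0 < s) (ht : 0 < t)
    (h : ∀ p : ℕ, t ≤ 2 ^ p * c p ^ s) :
    ∃ f : ℝ → ℝ, Set.SurjOn f (subsumSet c) (Set.Icc 0 1) ∧
      ∀ x ∈ subsumSet c, ∀ y ∈ subsumSet c, |f x - f y| ≤ 3 / t * |x - y| ^ s := by
  classical
  choose! g hg using fun x (hx : x ∈ subsumSet c) => hx
  refine ⟨fun x => Real.ofDigits (g x), ?_, ?_⟩
  · intro y hy
    obtain ⟨d, -, rfl⟩ := Real.ofDigits_SurjOn one_lt_two hy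
    refine ⟨subsum c d, ⟨d, rfl⟩, ?_⟩
    -- At distance 0 the Hölder bound says that all digit sequences of one subsum have the same
    -- binary value, so the choice of `g` is harmless.
    have h1 := hc.ofDigits_holder hs ht h (g (subsum c d)) d
    rw [hg _ ⟨d, rfl⟩, sub_self, abs_zero, Real.zero_rpow hs.ne', mul_zero] at h1
    exact sub_eq_zero.1 (abs_nonpos_iff.1 h1)
  · intro x hx y hy
    have h1 := hc.ofDigits_holder hs ht h (g x) (g y)
    rwa [hg x hx, hg y hy] at h1

lemma le_hausdorffMeasure_subsumSet (hc : Halving c) {s t : ℝ} (hs : 0 < s) (ht : 0 < t)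
    (h : ∀ p : ℕ, t ≤ 2 ^ p * c p ^ s) :
    ENNReal.ofReal (t / 3) ≤ Measure.hausdorffMeasure s (subsumSet c) := by
  obtain ⟨f, hf, hH⟩ := hc.exists_holder_surjOn hs ht h
  have hH' : HolderOnWith (3 / t).toNNReal s.toNNReal f (subsumSet c) := by
    intro x hx y hy
    rw [edist_dist, edist_dist, Real.dist_eq, Real.dist_eq, Real.coe_toNNReal s hs.le,
      ENNReal.ofReal_rpow_of_nonneg (abs_nonneg _) hs.le,
      ← ENNReal.ofReal, ← ENNReal.ofReal_mul (by positivity)]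
    exact ENNReal.ofReal_le_ofReal (hH x hx y hy)
  have h1 := hH'.hausdorffMeasure_image_le (Real.toNNReal_pos.2 hs) zero_le_one
  rw [hausdorffMeasure_real, ENNReal.rpow_one, mul_one, Real.coe_toNNReal s hs.le] at h1
  have h2 : (1 : ENNReal) ≤ volume (f '' subsumSet c) := by
    calc (1 : ENNReal) = volume (Set.Icc (0 : ℝ) 1) := by simp
      _ ≤ _ := measure_mono hf
  have h3 := h2.trans h1
  calc ENNReal.ofReal (t / 3) ≤ ENNReal.ofReal (t / 3) *
        (ENNReal.ofReal (3 / t) * Measure.hausdorffMeasure s (subsumSet c)) :=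
        le_mul_of_one_le_right zero_le h3
    _ = Measure.hausdorffMeasure s (subsumSet c) := by
        rw [← mul_assoc, ← ENNReal.ofReal_mul (by positivity),
          show t / 3 * (3 / t) = 1 by field_simp, ENNReal.ofReal_one, one_mul]

/-- The `2 ^ p` prefixes give intervals of length `2 * c p`; the measure is at most a lower limit
over `p`, so infinitely many good `p` suffice. -/
lemma hausdorffMeasure_subsumSet_le (hc : Halving c) {s B : ℝ} (hs : 0 < s)
    (h : ∃ᶠ p : ℕ in atTop, 2 ^ p * c p ^ s ≤ B) :
    Measure.hausdorffMeasure s (subsumSet c) ≤ ENNReal.ofReal (2 ^ s * B) := by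
  classical
  refine (Measure.hausdorffMeasure_le_liminf_sum (β := ℕ) (l := atTop)
    (ι := fun p => (Finset.range p).powerset) s (subsumSet c)
    (fun p => ENNReal.ofReal (2 * c p)) ?_
    (fun p v => Set.Icc (∑ i ∈ v.1, c i) (∑ i ∈ v.1, c i + 2 * c p)) ?_ ?_).trans ?_
  · simpa using ENNReal.tendsto_ofReal (hc.tendsto_zero.const_mul 2)
  · exact Eventually.of_forall fun p v => by simp [Real.ediam_Icc]
  · refine Eventually.of_forall fun p => ?_
    rintro x ⟨d, rfl⟩
    refine Set.mem_iUnion.2 ⟨⟨(Finset.range p).filter fun i => d i = 1, by simp⟩, ?_⟩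
    have h1 : ∑ i ∈ (Finset.range p).filter (fun i => d i = 1), c i =
        ∑ i ∈ Finset.range p, ((d i : ℕ) : ℝ) * c i := by
      rw [Finset.sum_filter]
      refine Finset.sum_congr rfl fun i _ => ?_
      generalize d i = a
      fin_cases a <;> simp
    have h2 := (hc.shift p).subsum_nonneg (fun i => d (i + p))
    have h3 := (hc.shift p).subsum_le (fun i => d (i + p))
    simp only [zero_add] at h3
    simp only [Set.mem_Icc, h1]
    rw [hc.subsum_split d p]
    constructor <;> linarith
  · refine Filter.liminf_le_of_frequently_le' (h.mono fun p hp => ?_)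
    have hpos := hc.pos p
    simp only [Real.ediam_Icc, add_sub_cancel_left, Finset.sum_const, Finset.card_univ,
      Fintype.card_coe, Finset.card_powerset, Finset.card_range, nsmul_eq_mul]
    rw [ENNReal.ofReal_rpow_of_nonneg (by positivity) hs.le, ← ENNReal.ofReal_natCast,
      ← ENNReal.ofReal_mul (by positivity)]
    apply ENNReal.ofReal_le_ofReal
    rw [Real.mul_rpow (by norm_num) hpos.le]
    push_cast
    calc (2 : ℝ) ^ p * (2 ^ s * c p ^ s) = 2 ^ s * (2 ^ p * c p ^ s) := by ring
      _ ≤ 2 ^ s * B := by gcongr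

lemma subsumSet_comp_subset (c : ℕ → ℝ) {σ : ℕ → ℕ} (hσ : StrictMono σ) :
    subsumSet (fun i => c (σ i)) ⊆ subsumSet c := by
  rintro x ⟨d, rfl⟩
  refine ⟨Function.extend σ d 0, ?_⟩
  rw [subsum, subsum, ← hσ.injective.tsum_eq]
  · simp [hσ.injective.extend_apply]
  · intro i hi
    by_contra hn
    exact hi (by simp [Function.extend_apply' _ _ _ hn])

lemma subsumSet_shift_succ_subset (c : ℕ → ℝ) :
    subsumSet (fun i => c (i + 1)) ⊆ subsumSet c :=
  subsumSet_comp_subset c (σ := fun i => i + 1) fun a b h => by simpa using h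

lemma add_mem_subsumSet (hc : Halving c) {x : ℝ} (hx : x ∈ subsumSet fun i => c (i + 1)) :
    c 0 + x ∈ subsumSet c := by
  obtain ⟨d, rfl⟩ := hx
  refine ⟨fun i => if i = 0 then 1 else d (i - 1), ?_⟩
  rw [hc.subsum_split _ 1]
  simp

end Halving

/-! ### Subsets of prescribed Hausdorff measure -/

/-- A subsequence along which `2 ^ p * w` stays bounded below while its lower limit is finite. -/
lemma exists_strictMono_two_pow_mul {w : ℕ → ℝ} (hw : Antitone w) (h0 : Tendsto w atTop (𝓝 0))
    {t : ℝ} (ht : 0 < t) (h : ∀ j : ℕ, t ≤ 2 ^ j * w j) :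
    ∃ σ : ℕ → ℕ, StrictMono σ ∧ (∀ p : ℕ, t ≤ 2 ^ p * w (σ p)) ∧
      ∃ᶠ p : ℕ in atTop, 2 ^ p * w (σ p) ≤ 2 * t := by
  classical
  -- `V p i`: index `i` may occupy place `p`, since continuing with consecutive indices keeps the
  -- lower bound. `σ p` is the largest such index.
  let V : ℕ → ℕ → Prop := fun p i => ∀ q : ℕ, t ≤ 2 ^ (p + q) * w (i + q)
  have hV0 : ∀ p, V p p := fun p q => h _
  have hVb : ∀ p, ∃ N, ∀ i, V p i → i ≤ N := by
    intro p
    have h1 : Tendsto (fun i => 2 ^ p * w i) atTop (𝓝 0) := by simpa using h0.const_mul (2 ^ p)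
    obtain ⟨N, hN⟩ := eventually_atTop.1 (h1.eventually (eventually_lt_nhds ht))
    refine ⟨N, fun i hi => ?_⟩
    by_contra hlt
    have h2 := hi 0
    have h3 := hN i (by omega)
    simp only [add_zero] at h2
    linarith
  have hex : ∀ p, ∃ i, V p i ∧ ∀ j, V p j → j ≤ i := by
    intro p
    obtain ⟨N, hN⟩ := hVb p
    exact ⟨Nat.findGreatest (V p) N, Nat.findGreatest_spec (hN p (hV0 p)) (hV0 p),
      fun j hj => Nat.le_findGreatest (hN j hj) hj⟩
  choose σ hσ hmax using hex
  have hstep : ∀ p, σ p + 1 ≤ σ (p + 1) := fun p => hmax _ _ fun q => by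
    have := hσ p (q + 1)
    rwa [show p + (q + 1) = p + 1 + q by omega, show σ p + (q + 1) = σ p + 1 + q by omega] at this
  have hmono : StrictMono σ := strictMono_nat_of_lt_succ fun p => hstep p
  have hadd : ∀ p q, σ p + q ≤ σ (p + q) := by
    intro p q
    induction q with
    | zero => simp
    | succ q ih =>
      have := hstep (p + q)
      change σ p + (q + 1) ≤ σ (p + q + 1)
      omega
  refine ⟨σ, hmono, fun p => by simpa using hσ p 0, ?_⟩
  refine frequently_atTop.2 fun p => ?_
  -- By maximality the index `σ p + 1` fails at some later `q`; as `σ` has advanced at least as far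
  -- one place later, the value there is at most `2 * t`.
  have hnot : ¬ V p (σ p + 1) := fun hv => by have := hmax p _ hv; omega
  simp only [V, not_forall, not_le] at hnot
  obtain ⟨q, hq⟩ := hnot
  refine ⟨p + (q + 1), by omega, ?_⟩
  have h1 : w (σ (p + (q + 1))) ≤ w (σ p + 1 + q) :=
    hw (by have := hadd p (q + 1); omega)
  calc (2 : ℝ) ^ (p + (q + 1)) * w (σ (p + (q + 1)))
      ≤ 2 ^ (p + (q + 1)) * w (σ p + 1 + q) := by gcongr
    _ = 2 * (2 ^ (p + q) * w (σ p + 1 + q)) := by rw [← add_assoc, pow_succ]; ring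
    _ ≤ 2 * t := by gcongr

namespace Halving

variable {c : ℕ → ℝ}

lemma exists_finite_measure (hc : Halving c) {s t : ℝ} (hs : 0 < s) (ht : 0 < t)
    (h : ∀ j : ℕ, t ≤ 2 ^ j * c j ^ s) :
    ∃ K ⊆ subsumSet c, IsCompact K ∧ ENNReal.ofReal (t / 3) ≤ Measure.hausdorffMeasure s K ∧
      Measure.hausdorffMeasure s K < ⊤ := by
  obtain ⟨σ, hσ, h1, h2⟩ := exists_strictMono_two_pow_mul (w := fun j => c j ^ s)
    (fun i j hij => Real.rpow_le_rpow (hc.pos j).le (hc.antitone hij) hs.le)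
    (by simpa [Real.zero_rpow hs.ne'] using hc.tendsto_zero.rpow_const (Or.inr hs.le)) ht h
  have hcσ := hc.comp hσ
  exact ⟨_, subsumSet_comp_subset c hσ, hcσ.isCompact_subsumSet,
    hcσ.le_hausdorffMeasure_subsumSet hs ht h1,
    (hcσ.hausdorffMeasure_subsumSet_le hs h2).trans_lt ENNReal.ofReal_lt_top⟩

/-- One more free binary digit doubles the Hausdorff measure. -/
lemma exists_double (hc : Halving c) {s : ℝ} (hs : 0 ≤ s)
    (hlt : ∀ x ∈ subsumSet (fun i => c (i + 1)), x < c 0) {K : Set ℝ}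
    (hK : K ⊆ subsumSet fun i => c (i + 1)) (hKc : IsCompact K) :
    ∃ L ⊆ subsumSet c, IsCompact L ∧
      Measure.hausdorffMeasure s L = 2 * Measure.hausdorffMeasure s K := by
  refine ⟨K ∪ (fun x => c 0 + x) '' K, ?_, hKc.union (hKc.image (by fun_prop)), ?_⟩
  · refine Set.union_subset (hK.trans (subsumSet_shift_succ_subset c)) ?_
    rintro _ ⟨x, hx, rfl⟩
    exact hc.add_mem_subsumSet (hK hx)
  · rw [measure_union _ (hKc.image (by fun_prop)).measurableSet,
      (isometry_add_left (c 0)).hausdorffMeasure_image (Or.inl hs), two_mul]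
    refine Set.disjoint_left.2 ?_
    rintro _ hx ⟨y, hy, rfl⟩
    have h1 := hlt _ (hK hx)
    obtain ⟨d, hd⟩ := hK hy
    have h2 := (hc.shift 1).subsum_nonneg d
    rw [show subsum (fun i => c (i + 1)) d = y from hd] at h2
    linarith

/-- For an exactly geometric sequence the tail can sum to `c 0`; a single strict drop excludes this,
which makes the two translates in `exists_double` disjoint. -/
lemma lt_of_mem_shift (hc : Halving c) (hdrop : ∃ i, 2 * c (i + 1) < c i) :
    ∀ x ∈ subsumSet (fun i => c (i + 1)), x < c 0 := by
  obtain ⟨i, hi⟩ := hdrop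
  rintro _ ⟨d, rfl⟩
  have h1 : ∀ n, ∑ j ∈ Finset.range n, ((d j : ℕ) : ℝ) * c (j + 1) + c n ≤ c 0 := by
    intro n
    induction n with
    | zero => simp
    | succ n ih =>
      rw [Finset.sum_range_succ]
      have := mul_le_mul_of_nonneg_right (fin_two_cast_le_one (d n)) (hc.pos (n + 1)).le
      linarith [hc.half n]
  rw [(hc.shift 1).subsum_split d i]
  have h2 := ((hc.shift 1).shift i).subsum_le fun j => d (j + i)
  have h3 := h1 i
  simp only [zero_add] at h2
  linarith

lemma exists_large_measure (hc : Halving c) (hdrop : ∀ n, ∃ i, n ≤ i ∧ 2 * c (i + 1) < c i)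
    {s : ℝ} (hs : 0 < s) {i : ℕ} {m : ENNReal}
    (h : ∃ K ⊆ subsumSet (fun j => c (j + i)), IsCompact K ∧
      m ≤ Measure.hausdorffMeasure s K ∧ Measure.hausdorffMeasure s K < ⊤) :
    ∃ K ⊆ subsumSet c, IsCompact K ∧
      2 ^ i * m ≤ Measure.hausdorffMeasure s K ∧ Measure.hausdorffMeasure s K < ⊤ := by
  induction i generalizing m with
  | zero => simpa using h
  | succ i ih =>
    obtain ⟨K, hK, hKc, hm, hfin⟩ := h
    have hci := hc.shift i
    obtain ⟨L, hL, hLc, hLm⟩ := hci.exists_double hs.le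
      (hci.lt_of_mem_shift (by
        obtain ⟨n, hn, hd⟩ := hdrop i
        refine ⟨n - i, ?_⟩
        rwa [show n - i + 1 + i = n + 1 by omega, show n - i + i = n by omega]))
      (K := K) (by simpa only [add_assoc, add_comm, add_left_comm] using hK) hKc
    have := ih (m := 2 * m) ⟨L, hL, hLc, by rw [hLm]; gcongr,
      by rw [hLm]; exact ENNReal.mul_lt_top (by simp) hfin⟩
    rwa [← mul_assoc, ← pow_succ] at this

end Halving

/-- A finite measure without atoms takes every intermediate value on initial segments of a compact
set. -/
lemma exists_compact_subset_measure_eq {μ : Measure ℝ} (hμ : ∀ x, μ {x} = 0) {K : Set ℝ}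
    (hK : IsCompact K) (hfin : μ K < ⊤) {m : ENNReal} (hm0 : 0 < m) (hm : m ≤ μ K) :
    ∃ L ⊆ K, IsCompact L ∧ μ L = m := by
  have hKm := hK.measurableSet
  obtain ⟨a, ha⟩ := hK.bddBelow
  obtain ⟨b, hb⟩ := hK.bddAbove
  let A : Set ℝ := {τ | m ≤ μ (K ∩ Set.Iic τ)}
  have hbA : b ∈ A := by
    have : K ∩ Set.Iic b = K := Set.inter_eq_left.2 fun x hx => hb hx
    simpa [A, this] using hm
  have hAb : BddBelow A := by
    refine ⟨a, fun τ hτ => ?_⟩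
    by_contra hlt
    have : K ∩ Set.Iic τ = ∅ := by
      ext x
      simp only [Set.mem_inter_iff, Set.mem_Iic, Set.mem_empty_iff_false, iff_false, not_and]
      intro hx hxτ
      have := ha hx
      linarith
    simp [A, this, hm0.ne'] at hτ
  set τ := sInf A with hτ
  have hup : ∀ x, τ < x → m ≤ μ (K ∩ Set.Iic x) := by
    intro x hx
    obtain ⟨y, hy, hyx⟩ := exists_lt_of_csInf_lt ⟨b, hbA⟩ hx
    exact le_trans hy (measure_mono (Set.inter_subset_inter_right _ (Set.Iic_subset_Iic.2 hyx.le)))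
  have hlow : ∀ x, x < τ → μ (K ∩ Set.Iic x) ≤ m := by
    intro x hx
    by_contra hlt
    exact absurd (csInf_le hAb (show x ∈ A from (not_le.1 hlt).le)) (not_le.2 hx)
  refine ⟨K ∩ Set.Iic τ, Set.inter_subset_left, hK.inter_right isClosed_Iic, le_antisymm ?_ ?_⟩
  · have h1 : μ (K ∩ Set.Iic τ) ≤ μ (K ∩ Set.Iio τ) := by
      calc μ (K ∩ Set.Iic τ) ≤ μ (K ∩ Set.Iio τ ∪ {τ}) := by
            refine measure_mono fun x hx => ?_
            rcases (show x ≤ τ from hx.2).lt_or_eq with h | h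
            · exact Or.inl ⟨hx.1, h⟩
            · exact Or.inr h
        _ ≤ μ (K ∩ Set.Iio τ) + μ {τ} := measure_union_le _ _
        _ = _ := by rw [hμ, add_zero]
    refine h1.trans ?_
    obtain ⟨u, hu, hlt, hlim⟩ := exists_seq_strictMono_tendsto τ
    have h2 : K ∩ Set.Iio τ ⊆ ⋃ n, K ∩ Set.Iic (u n) := by
      rintro x ⟨hx, hxτ⟩
      obtain ⟨n, hn⟩ := (hlim.eventually (eventually_gt_nhds hxτ)).exists
      exact Set.mem_iUnion.2 ⟨n, hx, hn.le⟩
    refine (measure_mono h2).trans ?_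
    rw [Monotone.measure_iUnion]
    · exact iSup_le fun n => hlow _ (hlt n)
    · exact fun i j hij => Set.inter_subset_inter_right _ (Set.Iic_subset_Iic.2 (hu.monotone hij))
  · obtain ⟨u, hu, hlt, hlim⟩ := exists_seq_strictAnti_tendsto τ
    have h2 : ⋂ n, K ∩ Set.Iic (u n) ⊆ K ∩ Set.Iic τ := by
      intro x hx
      rw [Set.mem_iInter] at hx
      exact ⟨(hx 0).1, ge_of_tendsto' hlim fun n => (hx n).2⟩
    refine le_trans ?_ (measure_mono h2)
    rw [Antitone.measure_iInter]
    · exact le_iInf fun n => hup _ (hlt n)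
    · exact fun i j hij => Set.inter_subset_inter_right _ (Set.Iic_subset_Iic.2 (hu.antitone hij))
    · exact fun n => (hKm.inter measurableSet_Iic).nullMeasurableSet
    · exact ⟨0, ((measure_mono Set.inter_subset_left).trans_lt hfin).ne⟩

lemma Halving.exists_hausdorffMeasure_eq {c : ℕ → ℝ} (hc : Halving c)
    (hdrop : ∀ n, ∃ i, n ≤ i ∧ 2 * c (i + 1) < c i) {s : ℝ} (hs : 0 < s)
    (hgrow : Tendsto (fun i : ℕ => 2 ^ i * c i ^ s) atTop atTop) {m : ℝ} (hm : 0 < m) :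
    ∃ K ⊆ subsumSet c, IsCompact K ∧ Measure.hausdorffMeasure s K = ENNReal.ofReal m := by
  obtain ⟨i, hi⟩ := eventually_atTop.1 (hgrow.eventually_ge_atTop (3 * m))
  obtain ⟨K, hK, hKc, hKm, hfin⟩ := hc.exists_large_measure hdrop hs
    -- The tail yields measure at least `t / 3 = m / 2 ^ i`, and the `i` doublings bring this to
    -- `m`.
    ((hc.shift i).exists_finite_measure hs (t := 3 * m / 2 ^ i) (by positivity) fun j => by
      have := hi (j + i) (by omega)
      rw [div_le_iff₀ (by positivity)]
      rw [pow_add] at this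
      linarith)
  have hKm' : ENNReal.ofReal m ≤ Measure.hausdorffMeasure s K := by
    refine le_trans (le_of_eq ?_) hKm
    rw [show (2 : ENNReal) = ENNReal.ofReal 2 by simp, ← ENNReal.ofReal_pow (by norm_num),
      ← ENNReal.ofReal_mul (by positivity)]
    congr 1
    field_simp
  have hna := Measure.nullSingletonClass_hausdorff ℝ hs
  obtain ⟨L, hL, hLc, hLm⟩ := exists_compact_subset_measure_eq
    (fun x => measure_singleton x) hKc hfin (ENNReal.ofReal_pos.2 hm) hKm'
  exact ⟨L, hL.trans hK, hLc, hLm⟩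

/-! ### Transfinite diameters -/

/-- The product of the mutual distances of finitely many complex numbers. -/
noncomputable def distProd {n : ℕ} (z : Fin n → ℂ) : ℝ :=
  ∏ j : Fin n, ∏ k ∈ Finset.Ioi j, ‖z j - z k‖

lemma distProd_nonneg {n : ℕ} (z : Fin n → ℂ) : 0 ≤ distProd z :=
  Finset.prod_nonneg fun _ _ => Finset.prod_nonneg fun _ _ => norm_nonneg _

lemma distProd_eq_ite {n : ℕ} (z : Fin n → ℂ) :
    distProd z = ∏ j : Fin n, ∏ k : Fin n, if j < k then ‖z j - z k‖ else 1 := by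
  refine Finset.prod_congr rfl fun j _ => ?_
  rw [← Finset.prod_filter]
  congr 1
  ext k; simp

lemma distProd_eq_mul_succAbove {n : ℕ} (z : Fin (n + 1) → ℂ) (i : Fin (n + 1)) :
    distProd z = distProd (z ∘ i.succAbove) *
      ∏ k : Fin (n + 1), if k = i then 1 else ‖z i - z k‖ := by
  rw [distProd_eq_ite, distProd_eq_ite, Fin.prod_univ_succAbove _ i]
  simp_rw [Fin.prod_univ_succAbove _ i]
  simp only [lt_irrefl, if_false, one_mul, if_true, Fin.succAbove_ne, Function.comp,
    Fin.succAbove_lt_succAbove_iff]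
  rw [Finset.prod_mul_distrib, ← mul_assoc, mul_comm (_ * _), ← Finset.prod_mul_distrib]
  congr 1
  refine Finset.prod_congr rfl fun k _ => ?_
  rcases lt_or_gt_of_ne (Fin.succAbove_ne i k) with h | h
  · rw [if_neg h.not_gt, if_pos h, one_mul, norm_sub_rev]
  · rw [if_pos h, if_neg h.not_gt, mul_one]

/-- Each pair of points survives in all but two of the `n + 1` configurations with one point
deleted. This is what makes the diameters decrease. -/
lemma distProd_pow_eq {n : ℕ} (z : Fin (n + 1) → ℂ) :
    distProd z ^ (n + 1) = (∏ i, distProd (z ∘ Fin.succAbove i)) * distProd z ^ 2 := by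
  have h : ∏ i : Fin (n + 1), distProd z = (∏ i, distProd (z ∘ Fin.succAbove i)) *
      ∏ i, ∏ k : Fin (n + 1), if k = i then 1 else ‖z i - z k‖ := by
    rw [← Finset.prod_mul_distrib]
    exact Finset.prod_congr rfl fun i _ => distProd_eq_mul_succAbove z i
  rw [Finset.prod_const, Finset.card_univ, Fintype.card_fin] at h
  rw [h, sq]
  congr 1
  have h2 : distProd z = ∏ i, ∏ k : Fin (n + 1), if k < i then ‖z i - z k‖ else 1 := by
    rw [distProd_eq_ite, Finset.prod_comm]
    exact Finset.prod_congr rfl fun i _ => Finset.prod_congr rfl fun k _ => by rw [norm_sub_rev]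
  nth_rw 1 [h2]
  rw [distProd_eq_ite, ← Finset.prod_mul_distrib]
  refine Finset.prod_congr rfl fun i _ => ?_
  rw [← Finset.prod_mul_distrib]
  refine Finset.prod_congr rfl fun k _ => ?_
  rcases lt_trichotomy k i with h | h | h
  · simp [h, h.ne, h.not_gt]
  · simp [h]
  · simp [h, h.ne', h.not_gt]

lemma distProd_le_maxDistProd {E : Set ℂ} (hE : Bornology.IsBounded E) {n : ℕ} (z : Fin n → E) :
    distProd (fun i => (z i : ℂ)) ≤ maxDistProd E n := by
  obtain ⟨D, hD⟩ := Metric.isBounded_iff.1 hE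
  refine le_ciSup (f := fun z : Fin n → E => distProd fun i => (z i : ℂ)) ?_ z
  refine ⟨∏ j : Fin n, ∏ k ∈ Finset.Ioi j, D, ?_⟩
  rintro _ ⟨w, rfl⟩
  refine Finset.prod_le_prod (fun _ _ => Finset.prod_nonneg fun _ _ => norm_nonneg _)
    fun j _ => Finset.prod_le_prod (fun _ _ => norm_nonneg _) fun k _ => ?_
  rw [← dist_eq_norm]
  exact hD (w j).2 (w k).2

lemma maxDistProd_nonneg (E : Set ℂ) (n : ℕ) : 0 ≤ maxDistProd E n :=
  Real.iSup_nonneg fun z => distProd_nonneg fun i => (z i : ℂ)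

lemma distProd_pow_le {E : Set ℂ} (hE : Bornology.IsBounded E) {n : ℕ} (hn : 1 ≤ n)
    (z : Fin (n + 1) → E) :
    distProd (fun i => (z i : ℂ)) ^ (n - 1) ≤ maxDistProd E n ^ (n + 1) := by
  set V := distProd (fun i => (z i : ℂ)) with hV
  have h1 := distProd_pow_eq (fun i => (z i : ℂ))
  have h2 : ∏ i, distProd ((fun i => (z i : ℂ)) ∘ Fin.succAbove i) ≤ maxDistProd E n ^ (n + 1) := by
    calc _ ≤ ∏ _i : Fin (n + 1), maxDistProd E n :=
          Finset.prod_le_prod (fun _ _ => distProd_nonneg _)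
            fun i _ => distProd_le_maxDistProd hE (z ∘ Fin.succAbove i)
      _ = _ := by simp
  rw [← hV] at h1
  rcases (distProd_nonneg (fun i => (z i : ℂ))).eq_or_lt with h0 | h0
  · rw [← hV] at h0
    rcases hn.eq_or_lt with rfl | hn
    · refine le_trans ?_ h2
      simp [distProd]
    · rw [← h0, zero_pow (by omega)]
      exact pow_nonneg (maxDistProd_nonneg E n) _
  · rw [← hV] at h0
    have h3 : V ^ (n + 1) = V ^ (n - 1) * V ^ 2 := by
      rw [← pow_add]; congr 1; omega
    rw [h3] at h1
    rw [mul_right_cancel₀ (by positivity) h1]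
    exact h2

lemma nthDiameter_nonneg (E : Set ℂ) (n : ℕ) : 0 ≤ nthDiameter E n :=
  Real.rpow_nonneg (maxDistProd_nonneg E n) _

lemma nthDiameter_succ_le {E : Set ℂ} (hE : Bornology.IsBounded E) (hne : E.Nonempty) {n : ℕ}
    (hn : 2 ≤ n) : nthDiameter E (n + 1) ≤ nthDiameter E n := by
  have : Nonempty E := hne.to_subtype
  have hP := maxDistProd_nonneg E n
  have hn' : (2 : ℝ) ≤ n := by exact_mod_cast hn
  have hcast : ((n - 1 : ℕ) : ℝ) = n - 1 := by push_cast [Nat.cast_sub (by omega : 1 ≤ n)]; rfl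
  have h1 : maxDistProd E (n + 1) ≤ (maxDistProd E n ^ (n + 1)) ^ (((n - 1 : ℕ) : ℝ)⁻¹) := by
    refine ciSup_le fun z => ?_
    refine (Real.le_rpow_inv_iff_of_pos (distProd_nonneg fun i => (z i : ℂ)) (by positivity)
      (by rw [hcast]; linarith)).2 ?_
    rw [Real.rpow_natCast]
    exact distProd_pow_le hE (by omega) z
  unfold nthDiameter
  calc maxDistProd E (n + 1) ^ (2 / (((n + 1 : ℕ) : ℝ) * (((n + 1 : ℕ) : ℝ) - 1)))
      ≤ ((maxDistProd E n ^ (n + 1)) ^ (((n - 1 : ℕ) : ℝ)⁻¹)) ^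
        (2 / (((n + 1 : ℕ) : ℝ) * (((n + 1 : ℕ) : ℝ) - 1))) := by
        refine Real.rpow_le_rpow (maxDistProd_nonneg E _) h1 ?_
        push_cast
        rw [add_sub_cancel_right]
        positivity
    _ = maxDistProd E n ^ (2 / ((n : ℝ) * ((n : ℝ) - 1))) := by
        rw [← Real.rpow_natCast, ← Real.rpow_mul hP, ← Real.rpow_mul hP, hcast]
        congr 1
        push_cast
        have h2 : (n : ℝ) - 1 ≠ 0 := by linarith
        have h3 : (n : ℝ) ≠ 0 := by linarith
        have h4 : (n : ℝ) + 1 ≠ 0 := by linarith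
        rw [add_sub_cancel_right]
        field_simp

lemma exists_isLogCapacity {E : Set ℂ} (hE : Bornology.IsBounded E) {δ : ℝ} (hδ : 0 < δ)
    (h : ∀ n, 2 ≤ n → ∃ z : Fin n → E, δ ^ (n * (n - 1)) ≤ distProd fun i => (z i : ℂ)) :
    ∃ κ : ℝ, IsLogCapacity E κ ∧ 0 < κ := by
  have hne : E.Nonempty := by
    obtain ⟨z, -⟩ := h 2 le_rfl
    exact ⟨z 0, (z 0).2⟩
  have hanti : Antitone fun n => nthDiameter E (n + 2) :=
    antitone_nat_of_succ_le fun n => nthDiameter_succ_le hE hne (by omega)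
  have hbdd : BddBelow (Set.range fun n => nthDiameter E (n + 2)) :=
    ⟨0, by rintro _ ⟨n, rfl⟩; exact nthDiameter_nonneg E _⟩
  have hlim := tendsto_atTop_ciInf hanti hbdd
  refine ⟨_, (tendsto_add_atTop_iff_nat 2).1 hlim, lt_of_lt_of_le (pow_pos hδ 2) (le_ciInf ?_)⟩
  intro m
  obtain ⟨z, hz⟩ := h (m + 2) (by omega)
  have h1 := hz.trans (distProd_le_maxDistProd hE z)
  have h2 := Real.rpow_le_rpow (pow_nonneg hδ.le _) h1
    (z := 2 / (((m + 2 : ℕ) : ℝ) * (((m + 2 : ℕ) : ℝ) - 1))) (by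
      push_cast
      have : (0 : ℝ) ≤ (m : ℝ) + 2 - 1 := by linarith [(Nat.cast_nonneg m : (0 : ℝ) ≤ m)]
      positivity)
  refine le_trans (le_of_eq ?_) h2
  rw [← Real.rpow_natCast, ← Real.rpow_natCast, ← Real.rpow_mul hδ.le]
  congr 1
  have : (m : ℝ) + 2 - 1 ≠ 0 := by linarith [(Nat.cast_nonneg m : (0 : ℝ) ≤ m)]
  rw [Nat.add_sub_assoc (by norm_num)]
  push_cast
  field_simp
  ring

lemma prod_Ioi_sub_eq (n : ℕ) (j : Fin n) :
    ∏ k ∈ Finset.Ioi j, (((k : ℕ) : ℝ) - ((j : ℕ) : ℝ)) = ((n - 1 - j : ℕ).factorial : ℝ) := by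
  have h : ∏ k ∈ Finset.Ioi j, (((k : ℕ) : ℝ) - ((j : ℕ) : ℝ)) =
      ∏ k ∈ Finset.Ioo (j : ℕ) n, ((k : ℝ) - ((j : ℕ) : ℝ)) := by
    rw [← Fin.map_valEmbedding_Ioi, Finset.prod_map]
    rfl
  rw [h, ← Finset.prod_range_add_one_eq_factorial, Nat.cast_prod]
  refine Finset.prod_bij' (fun k _ => k - j - 1) (fun i _ => i + j + 1) ?_ ?_ ?_ ?_ ?_
  · intro k hk; simp only [Finset.mem_Ioo, Finset.mem_range] at hk ⊢; omega
  · intro k hk; simp only [Finset.mem_Ioo, Finset.mem_range] at hk ⊢; omega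
  · intro k hk; simp only [Finset.mem_Ioo] at hk; omega
  · intro k hk; omega
  · intro k hk
    simp only [Finset.mem_Ioo] at hk
    rw [← Nat.cast_sub hk.1.le]
    congr 1
    omega

/-- A compact set that maps onto `[0, 1]` by a `1 / 2`-Hölder map has positive capacity. -/
lemma exists_isLogCapacity_of_holder {E : Set ℝ} (hE : IsCompact E) {f : ℝ → ℝ} {A : ℝ}
    (hA : 0 < A) (hf : Set.SurjOn f E (Set.Icc 0 1))
    (hH : ∀ x ∈ E, ∀ y ∈ E, |f x - f y| ≤ A * |x - y| ^ (1 / 2 : ℝ)) :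
    ∃ κ : ℝ, IsLogCapacity (Complex.ofReal '' E) κ ∧ 0 < κ := by
  refine exists_isLogCapacity (hE.image Complex.continuous_ofReal).isBounded
    (Real.exp_pos (-(4 * A))) fun n hn => ?_
  have hn0 : (0 : ℝ) < n := by exact_mod_cast (by omega : 0 < n)
  -- Preimages of `j / n`: the Hölder bound separates the `j`-th and `k`-th by at least `((k - j) /
  -- (n * A)) ^ 2`.
  have hpt : ∀ j : Fin n, ∃ x ∈ E, f x = ((j : ℕ) : ℝ) / n := fun j =>
    hf ⟨by positivity, (div_le_one hn0).2 (by exact_mod_cast j.2.le)⟩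
  choose x hxE hx using hpt
  refine ⟨fun j => ⟨x j, x j, hxE j, rfl⟩, ?_⟩
  have hpair : ∀ j k : Fin n, j < k →
      ((((k : ℕ) : ℝ) - ((j : ℕ) : ℝ)) / (n * A)) ^ 2 ≤ ‖((x j : ℂ)) - (x k : ℂ)‖ := by
    intro j k hjk
    have h1 := hH _ (hxE k) _ (hxE j)
    have hjk' : ((j : ℕ) : ℝ) ≤ ((k : ℕ) : ℝ) := by exact_mod_cast hjk.le
    rw [hx, hx, ← sub_div, abs_of_nonneg (div_nonneg (sub_nonneg.2 hjk') hn0.le)] at h1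
    rw [← Complex.ofReal_sub, Complex.norm_real, Real.norm_eq_abs, abs_sub_comm]
    have h2 : (((k : ℕ) : ℝ) - ((j : ℕ) : ℝ)) / (n * A) ≤ |x k - x j| ^ (1 / 2 : ℝ) := by
      rw [← div_div, div_le_iff₀ hA, mul_comm]
      exact h1
    calc _ ≤ (|x k - x j| ^ (1 / 2 : ℝ)) ^ 2 :=
          pow_le_pow_left₀ (div_nonneg (sub_nonneg.2 hjk') (by positivity)) h2 2
      _ = |x k - x j| := by
          rw [← Real.rpow_natCast, ← Real.rpow_mul (abs_nonneg _)]
          norm_num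
  have hrow : ∀ j : Fin n, Real.exp (-(n * A)) ^ 2 ≤
      ∏ k ∈ Finset.Ioi j, ‖((x j : ℂ)) - (x k : ℂ)‖ := by
    intro j
    calc Real.exp (-(n * A)) ^ 2 ≤
          (((n - 1 - j : ℕ).factorial : ℝ) / (n * A) ^ (n - 1 - j : ℕ)) ^ 2 := by
          gcongr
          rw [Real.exp_neg, inv_le_comm₀ (Real.exp_pos _) (by positivity), inv_div]
          exact Real.pow_div_factorial_le_exp _ (by positivity) _
      _ = ∏ k ∈ Finset.Ioi j, ((((k : ℕ) : ℝ) - ((j : ℕ) : ℝ)) / (n * A)) ^ 2 := by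
          rw [Finset.prod_pow, Finset.prod_div_distrib, prod_Ioi_sub_eq, Finset.prod_const,
            Fin.card_Ioi]
      _ ≤ _ := Finset.prod_le_prod (fun _ _ => sq_nonneg _)
          fun k hk => hpair j k (Finset.mem_Ioi.1 hk)
  calc Real.exp (-(4 * A)) ^ (n * (n - 1)) ≤ ∏ _j : Fin n, Real.exp (-(n * A)) ^ 2 := by
        rw [Finset.prod_const, Finset.card_univ, Fintype.card_fin, ← Real.exp_nat_mul,
          ← Real.exp_nat_mul, ← Real.exp_nat_mul]
        -- The constant 4 comes from `2 * n ^ 2 ≤ 4 * n * (n - 1)` for `n ≥ 2`.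
        apply Real.exp_le_exp.2
        have hn2 : (2 : ℝ) ≤ n := by exact_mod_cast hn
        push_cast [Nat.cast_sub (by omega : 1 ≤ n)]
        have h5 : 0 ≤ (n : ℝ) * A * (n - 2) := by
          apply mul_nonneg (by positivity); linarith
        nlinarith
    _ ≤ _ := Finset.prod_le_prod (fun _ _ => by positivity) fun j _ => hrow j

/-! ### Wide gaps exclude uniformly perfect subsets -/

/-- Every point of `W` is surrounded by annuli of arbitrarily large modulus separating it from
some other point of `W`. -/
def HasWideGaps (W : Set ℝ) : Prop :=
  ∀ x ∈ W, ∀ M : ℝ, 1 < M →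
    ∃ r R : ℝ, 0 < r ∧ 0 < R ∧ M ≤ R / r ∧
      {y : ℝ | r < |y - x| ∧ |y - x| < R} ⊆ Wᶜ ∧ ({y : ℝ | R ≤ |y - x|} ∩ W).Nonempty

lemma HasWideGaps.hnup {W K : Set ℝ} (hW : HasWideGaps W) (hWc : IsCompact W) (hK : K ⊆ W)
    (hKc : IsCompact K) : HNUP (Complex.ofReal '' K) := by
  refine ⟨hKc.image Complex.continuous_ofReal, ?_⟩
  rintro F hF ⟨-, ⟨a, ha, b, hb, hab⟩, C, hC⟩
  obtain ⟨x, hx, rfl⟩ := hF ha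
  obtain ⟨y, hy, rfl⟩ := hF hb
  have hxy : 0 < |y - x| := abs_pos.2 (sub_ne_zero.2 fun h => hab (by rw [h]))
  obtain ⟨D, hD⟩ := Metric.isBounded_iff.1 hWc.isBounded
  have hDpos : |y - x| ≤ D := hD (hK hy) (hK hx)
  -- `M > exp C` contradicts the modulus bound. `M > D / |y - x|` with `R ≤ D` forces `r < |y - x|`,
  -- so `y` lies beyond the gap and the annulus separates `F` itself, not only `W`.
  obtain ⟨M, hM⟩ : ∃ M : ℝ, 1 < M ∧ Real.exp C < M ∧ D / |y - x| < M :=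
    ⟨max (max 1 (Real.exp C)) (D / |y - x|) + 1, by
      have h1 := le_max_left (max 1 (Real.exp C)) (D / |y - x|)
      have h2 := le_max_right (max 1 (Real.exp C)) (D / |y - x|)
      have h3 := le_max_left 1 (Real.exp C)
      have h4 := le_max_right 1 (Real.exp C)
      refine ⟨?_, ?_, ?_⟩ <;> linarith⟩
  obtain ⟨hM1, hMC, hMD⟩ := hM
  obtain ⟨r, R, hr, hR, hrR, hgap, z, hz, hzW⟩ := hW x (hK hx) M hM1
  have hRD : R ≤ D := le_trans hz (hD hzW (hK hx))
  rw [le_div_iff₀ hr] at hrR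
  have hlt : r < R := by nlinarith
  have hry : r < |y - x| := by
    rw [div_lt_iff₀ hxy] at hMD
    by_contra hle
    nlinarith
  have hRy : R ≤ |y - x| := by
    by_contra hlt'
    exact hgap ⟨hry, not_le.1 hlt'⟩ (hK hy)
  have hnorm : ∀ u v : ℝ, ‖(u : ℂ) - (v : ℂ)‖ = |u - v| := fun u v => by
    rw [← Complex.ofReal_sub, Complex.norm_real, Real.norm_eq_abs]
  have hlog := hC x r R hr hlt ⟨⟨x, ha, by simp [hr.le]⟩,
    ⟨y, hb, by simpa only [Set.mem_ofPred_eq, hnorm] using hRy⟩, by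
      rw [Set.eq_empty_iff_forall_notMem]
      rintro w ⟨hwF, hw⟩
      obtain ⟨u, hu, rfl⟩ := hF hwF
      simp only [Ann, Set.mem_ofPred_eq, hnorm] at hw
      exact hgap hw (hK hu)⟩
  rw [Real.log_le_iff_le_exp (by positivity), div_le_iff₀ hr] at hlog
  nlinarith

/-! ### The concrete sequence and the theorem -/

/-- `2 ^ (-(i + ⌊log₂ i⌋ ^ 2))`: essentially geometric, with sparse steep drops. -/
noncomputable def dropSeq (i : ℕ) : ℝ := (1 / 2) ^ (i + Nat.log 2 i ^ 2)

lemma halving_dropSeq : Halving dropSeq where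
  pos i := by unfold dropSeq; positivity
  half i := by
    unfold dropSeq
    have h1 : Nat.log 2 i ^ 2 ≤ Nat.log 2 (i + 1) ^ 2 :=
      Nat.pow_le_pow_left (Nat.log_mono_right (Nat.le_succ i)) 2
    have h2 : (1 / 2 : ℝ) ^ (i + 1 + Nat.log 2 (i + 1) ^ 2) ≤ (1 / 2) ^ (i + Nat.log 2 i ^ 2 + 1) :=
      pow_le_pow_of_le_one (by norm_num) (by norm_num) (by omega)
    rw [pow_succ _ (i + Nat.log 2 i ^ 2)] at h2
    linarith

lemma dropSeq_drop (m : ℕ) :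
    dropSeq (2 ^ (m + 1) - 1 + 1) = (1 / 2) ^ (2 * m + 2) * dropSeq (2 ^ (m + 1) - 1) := by
  have h0 : 2 ^ (m + 1) - 1 + 1 = 2 ^ (m + 1) := Nat.sub_add_cancel Nat.one_le_two_pow
  have h1 : Nat.log 2 (2 ^ (m + 1)) = m + 1 := Nat.log_pow one_lt_two _
  have h2 : Nat.log 2 (2 ^ (m + 1) - 1) = m := by
    rw [Nat.log_eq_iff (by
      rcases Nat.eq_zero_or_pos m with h | h
      · exact Or.inr ⟨by norm_num, by simp [h]⟩
      · exact Or.inl h.ne')]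
    have := Nat.one_le_two_pow (n := m)
    rw [pow_succ]
    omega
  rw [dropSeq, dropSeq, h0, h1, h2, ← pow_add]
  congr 1
  rw [← h0, Nat.add_sub_cancel]
  ring

lemma hasWideGaps_dropSeq : HasWideGaps (subsumSet dropSeq) := by
  intro x hx M hM
  obtain ⟨m, hm⟩ := pow_unbounded_of_one_lt M (by norm_num : (1 : ℝ) < 2)
  have hc := halving_dropSeq
  set i := 2 ^ (m + 1) - 1 with hi
  have hi1 : 1 ≤ i := by have := Nat.one_le_two_pow (n := m); rw [pow_succ] at hi; omega
  have hdrop := dropSeq_drop m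
  rw [← hi] at hdrop
  have hpos := hc.pos i
  have hsmall : (1 / 2 : ℝ) ^ (2 * m + 2) ≤ 1 / 4 * (1 / 2) ^ m := by
    calc (1 / 2 : ℝ) ^ (2 * m + 2) ≤ (1 / 2) ^ (m + 2) :=
          pow_le_pow_of_le_one (by norm_num) (by norm_num) (by omega)
      _ = _ := by rw [pow_add]; ring
  have hm1 : (1 / 2 : ℝ) ^ m ≤ 1 := pow_le_one₀ (by norm_num) (by norm_num)
  have hM' : M * (1 / 2 : ℝ) ^ m ≤ 1 := by
    rw [one_div, inv_pow, ← div_eq_mul_inv, div_le_one (by positivity)]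
    exact hm.le
  have hle : dropSeq (i + 1) ≤ 1 / 4 * (1 / 2) ^ m * dropSeq i := by
    rw [hdrop]; gcongr
  have hle' : dropSeq (i + 1) ≤ 1 / 4 * dropSeq i := by nlinarith
  have hi0 : 2 * dropSeq i ≤ dropSeq 0 :=
    le_trans (by linarith [hc.antitone hi1]) (hc.half 0)
  refine ⟨2 * dropSeq (i + 1), dropSeq i - 2 * dropSeq (i + 1), by linarith [hc.pos (i + 1)],
    by linarith, ?_, ?_, ?_⟩
  · rw [le_div_iff₀ (by linarith [hc.pos (i + 1)])]
    have h1 : M * dropSeq (i + 1) ≤ 1 / 4 * dropSeq i := by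
      calc M * dropSeq (i + 1) ≤ M * (1 / 4 * (1 / 2) ^ m * dropSeq i) := by gcongr
        _ = 1 / 4 * (M * (1 / 2) ^ m) * dropSeq i := by ring
        _ ≤ 1 / 4 * 1 * dropSeq i := by gcongr
        _ = _ := by ring
    linarith
  · rintro y ⟨h1, h2⟩ hy
    rcases hc.gap hx hy i with h | h <;> linarith
  -- The points `0` and `dropSeq 0` are at least `2 * dropSeq i` apart, so they cannot both be
  -- closer to `x` than `R < dropSeq i`.
  · have h0 := Halving.zero_mem dropSeq
    have h1 := Halving.apply_zero_mem dropSeq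
    by_contra hne
    have h2 : |0 - x| < dropSeq i - 2 * dropSeq (i + 1) := by
      by_contra h; exact hne ⟨0, not_lt.1 h, h0⟩
    have h3 : |dropSeq 0 - x| < dropSeq i - 2 * dropSeq (i + 1) := by
      by_contra h; exact hne ⟨_, not_lt.1 h, h1⟩
    rw [abs_lt] at h2 h3
    linarith [hc.pos (i + 1)]

lemma dropSeq_steep (n : ℕ) : ∃ i, n ≤ i ∧ 2 * dropSeq (i + 1) < dropSeq i := by
  refine ⟨2 ^ (n + 1) - 1, ?_, ?_⟩
  · have := Nat.lt_two_pow_self (n := n + 1)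
    omega
  · rw [dropSeq_drop]
    have h1 : (1 / 2 : ℝ) ^ (2 * n + 2) ≤ (1 / 2) ^ 2 :=
      pow_le_pow_of_le_one (by norm_num) (by norm_num) (by omega)
    have := halving_dropSeq.pos (2 ^ (n + 1) - 1)
    nlinarith

lemma two_pow_mul_dropSeq_rpow (s : ℝ) (i : ℕ) :
    2 ^ i * dropSeq i ^ s = (2 : ℝ) ^ ((1 - s) * i - s * (Nat.log 2 i : ℝ) ^ 2) := by
  rw [dropSeq, one_div, inv_pow, ← Real.rpow_natCast, ← Real.rpow_natCast,
    ← Real.rpow_neg two_pos.le, ← Real.rpow_mul two_pos.le, ← Real.rpow_add two_pos]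
  congr 1
  push_cast
  ring

lemma tendsto_log_sq_div : Tendsto (fun i : ℕ => (Nat.log 2 i : ℝ) ^ 2 / i) atTop (𝓝 0) := by
  have h1 : Tendsto (fun i : ℕ => Real.log i ^ 2 / (i : ℝ)) atTop (𝓝 0) :=
    ((Real.isLittleO_pow_log_id_atTop (n := 2)).tendsto_div_nhds_zero).comp
      tendsto_natCast_atTop_atTop
  have h2 := h1.const_mul ((Real.log 2 ^ 2)⁻¹)
  rw [mul_zero] at h2
  refine squeeze_zero (fun i => by positivity) (fun i => ?_) h2
  have h3 := Real.natLog_le_logb i 2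
  rw [Real.logb] at h3
  have h4 := pow_le_pow_left₀ (Nat.cast_nonneg _) h3 2
  rw [div_pow, Nat.cast_ofNat] at h4
  calc (Nat.log 2 i : ℝ) ^ 2 / i ≤ (Real.log i ^ 2 / Real.log 2 ^ 2) / i := by gcongr
    _ = _ := by ring

lemma tendsto_two_pow_mul_dropSeq {s : ℝ} (hs : s < 1) :
    Tendsto (fun i : ℕ => 2 ^ i * dropSeq i ^ s) atTop atTop := by
  simp_rw [two_pow_mul_dropSeq_rpow]
  refine (tendsto_rpow_atTop_of_base_gt_one 2 one_lt_two).comp ?_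
  have h1 : Tendsto (fun i : ℕ => (1 - s) - s * ((Nat.log 2 i : ℝ) ^ 2 / i)) atTop (𝓝 (1 - s)) := by
    simpa using (tendsto_log_sq_div.const_mul s).const_sub (1 - s)
  refine (Tendsto.atTop_mul_pos (sub_pos.2 hs) tendsto_natCast_atTop_atTop h1).congr' ?_
  filter_upwards [eventually_gt_atTop 0] with i hi
  have : (i : ℝ) ≠ 0 := by positivity
  field_simp

lemma hausdorffMeasure_one_dropSeq : Measure.hausdorffMeasure 1 (subsumSet dropSeq) = 0 := by
  refine le_antisymm (ENNReal.le_of_forall_pos_le_add fun ε hε _ => ?_) zero_le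
  rw [zero_add]
  have hε' : (0 : ℝ) < ε / 2 := by positivity
  obtain ⟨N, hN⟩ := exists_pow_lt_of_lt_one hε' (by norm_num : (1 / 2 : ℝ) < 1)
  -- At `i = 2 ^ (n + N)` the product `2 ^ i * dropSeq i` is `2 ^ (-(n + N) ^ 2)`.
  refine (halving_dropSeq.hausdorffMeasure_subsumSet_le one_pos (B := ε / 2)
    (frequently_atTop.2 fun n => ⟨2 ^ (n + N), ?_, ?_⟩)).trans (le_of_eq ?_)
  · exact (Nat.le_add_right n N).trans Nat.lt_two_pow_self.le
  · rw [Real.rpow_one, dropSeq, Nat.log_pow one_lt_two, pow_add (1 / 2 : ℝ), ← mul_assoc, ← mul_pow,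
      mul_one_div_cancel two_ne_zero, one_pow, one_mul]
    refine le_trans ?_ hN.le
    refine pow_le_pow_of_le_one (by norm_num) (by norm_num) ?_
    exact (Nat.le_add_left N n).trans (Nat.le_self_pow two_ne_zero _)
  · rw [Real.rpow_one, mul_div_cancel₀ _ two_ne_zero, ENNReal.ofReal_coe_nnreal]

lemma exists_isLogCapacity_dropSeq :
    ∃ κ : ℝ, IsLogCapacity (Complex.ofReal '' subsumSet dropSeq) κ ∧ 0 < κ := by
  -- A positive sequence tending to infinity attains its minimum, which serves as `t` for exponent
  -- `1 / 2`.
  obtain ⟨i, hi⟩ := Filter.Tendsto.exists_forall_le (Nat.cofinite_eq_atTop ▸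
    tendsto_two_pow_mul_dropSeq (by norm_num : (1 / 2 : ℝ) < 1))
  have ht : (0 : ℝ) < 2 ^ i * dropSeq i ^ (1 / 2 : ℝ) :=
    mul_pos (by positivity) (Real.rpow_pos_of_pos (halving_dropSeq.pos i) _)
  obtain ⟨f, hf, hH⟩ := halving_dropSeq.exists_holder_surjOn one_half_pos ht hi
  exact exists_isLogCapacity_of_holder halving_dropSeq.isCompact_subsumSet (by positivity) hf hH

lemma dimH_eq_of_hausdorffMeasure_eq {K : Set ℝ} {s m : ℝ} (hs : 0 < s) (hm : 0 < m)
    (h : Measure.hausdorffMeasure s K = ENNReal.ofReal m) : dimH K = ENNReal.ofReal s := by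
  have hs' : ((s.toNNReal : NNReal) : ℝ) = s := Real.coe_toNNReal s hs.le
  refine dimH_of_hausdorffMeasure_ne_zero_ne_top (d := s.toNNReal) ?_ ?_ <;> rw [hs', h]
  · exact (ENNReal.ofReal_pos.2 hm).ne'
  · exact ENNReal.ofReal_ne_top

lemma dimH_dropSeq : dimH (subsumSet dropSeq) = 1 := by
  refine le_antisymm ((dimH_mono (Set.subset_univ _)).trans Real.dimH_univ.le) ?_
  refine le_of_forall_lt fun q hq => ?_
  obtain ⟨s, hqs, hs1⟩ := ENNReal.lt_iff_exists_nnreal_btwn.1 hq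
  have hs : (0 : ℝ) < s := NNReal.coe_pos.2 (ENNReal.coe_pos.1 (zero_le.trans_lt hqs))
  obtain ⟨K, hK, -, hKm⟩ := halving_dropSeq.exists_hausdorffMeasure_eq dropSeq_steep hs
    (tendsto_two_pow_mul_dropSeq (by exact_mod_cast hs1)) one_pos
  refine hqs.trans_le ?_
  rw [← ENNReal.ofReal_coe_nnreal, ← dimH_eq_of_hausdorffMeasure_eq hs one_pos hKm]
  exact dimH_mono hK

theorem theorem2 :
    ∃ W : Set ℝ,
      IsCompact W ∧ HNUP (Complex.ofReal '' W) ∧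
      dimH W = 1 ∧ Measure.hausdorffMeasure 1 W = 0 ∧
      (∃ κ : ℝ, IsLogCapacity (Complex.ofReal '' W) κ ∧ 0 < κ) ∧
      (∀ s c : ℝ, 0 < s → s < 1 → 0 < c →
        ∃ K : Set ℝ, K ⊆ W ∧ IsCompact K ∧ HNUP (Complex.ofReal '' K) ∧
          dimH K = ENNReal.ofReal s ∧ Measure.hausdorffMeasure s K = ENNReal.ofReal c) ∧
      (∀ x ∈ W, ∀ M : ℝ, 1 < M →
        ∃ r R : ℝ, 0 < r ∧ 0 < R ∧ M ≤ R / r ∧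
          {y : ℝ | r < |y - x| ∧ |y - x| < R} ⊆ Wᶜ ∧
          ({y : ℝ | R ≤ |y - x|} ∩ W).Nonempty) := by
  have hW := halving_dropSeq.isCompact_subsumSet
  refine ⟨subsumSet dropSeq, hW, hasWideGaps_dropSeq.hnup hW subset_rfl hW, dimH_dropSeq,
    hausdorffMeasure_one_dropSeq, exists_isLogCapacity_dropSeq, fun s c hs hs1 hc => ?_,
    hasWideGaps_dropSeq⟩
  obtain ⟨K, hK, hKc, hKm⟩ := halving_dropSeq.exists_hausdorffMeasure_eq dropSeq_steep hs
    (tendsto_two_pow_mul_dropSeq hs1) hc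
  exact ⟨K, hK, hKc, hasWideGaps_dropSeq.hnup hW hK hKc,
    dimH_eq_of_hausdorffMeasure_eq hs hc hKm, hKm⟩
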